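/- Let $\Omega\subset\mathbf R^3$ be a bounded open set, $b>0$, and let $f,g\in C_c(\Omega)$ be continuous functions with compact support in $\Omega$. Put $Y=(-\tfrac12,\tfrac12)^3$ and, for $\varepsilon>0$ and $k\in\mathbf Z^3$, $Y_\varepsilon^k=\varepsilon k+\varepsilon Y$ and $\mathbf Z_\varepsilon=\{k\in\mathbf Z^3 : Y_\varepsilon^k\subset\Omega\}$. Let $r_\varepsilon>0$ ($\varepsilon>0$) be radii such that $\lim_{\varepsilon\to0}r_\varepsilon/\varepsilon^3=\gamma$ for some $\gamma\in(0,+\infty)$ (in particular $r_\varepsilon/\varepsilon\to0$), and let $B(\varepsilon k,r_\varepsilon)$ be the ball of centre $\varepsilon k$ and radius $r_\varepsilon$. Set $$T_\varepsilon=\bigcup_{k\in\mathbf Z_\varepsilon}B(\varepsilon k,r_\varepsilon),\qquad \Omega_\varepsilon=\Omega\setminus T_\varepsilon .$$ Let $H_0^1(\Omega)$ be the closure of $C_c^\infty(\Omega)$ in $H^1(\Omega)$ and let $H^{-1}(\Omega)$ be its dual. (For all small enough $\varepsilon$ one has $T_\varepsilon\subset\Omega$; for the other $\varepsilon$ integrals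 over $T_\varepsilon$ are understood over $T_\varepsilon\cap\Omega$.) Define $\mathcal F_\varepsilon,\mathcal F\in H^{-1}(\Omega)$ by $$\mathcal F_\varepsilon(\varphi)=\int_{\Omega_\varepsilon}f\varphi\,dx+b\Big(\frac{\varepsilon}{r_\varepsilon}\Big)^3\int_{T_\varepsilon}g\varphi\,dx,\qquad \mathcal F(\varphi)=\int_\Omega f\varphi\,dx+\frac{4\pi b}{3}\int_\Omega g\varphi\,dx\qquad(\varphi\in H_0^1(\Omega)).$$ Then, as $\varepsilon\to0^+$, $\mathcal F_\varepsilon\rightharpoonup\mathcal F$ weakly in $H^{-1}(\Omega)$. -/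

import Mathlib

open MeasureTheory Filter Topology TopologicalSpace
open scoped Distributions ENNReal

noncomputable section

/-- Three-dimensional Euclidean space. -/
abbrev E3 : Type := EuclideanSpace ℝ (Fin 3)

/-- Lebesgue measure on `Ω`. -/
abbrev volOn (Ω : Opens E3) : Measure E3 := volume.restrict (Ω : Set E3)

/-- `C_c(Ω)`: continuous real functions with compact support contained in the open set `Ω`
(identified with their extensions by zero to the whole space). -/
abbrev CcFun (Ω : Opens E3) : Type := 𝓓^{0}(Ω, ℝ)

/-! ### The Sobolev spaces `H¹(Ω)`, `H₀¹(Ω)` and `H⁻¹(Ω)` -/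

/-- `L²(Ω) × L²(Ω; ℝ³)` with the Hilbert norm `‖(u, G)‖² = ‖u‖² + ‖G‖²`. -/
abbrev L2Pair (Ω : Opens E3) : Type := WithLp 2 (Lp ℝ 2 (volOn Ω) × Lp E3 2 (volOn Ω))

/-- `G` is the weak gradient of `u` in `Ω`: `∫_Ω u ∇ψ = - ∫_Ω ψ G` for all `ψ ∈ 𝓓(Ω)`. -/
def IsWeakGradient (Ω : Opens E3) (u : E3 → ℝ) (G : E3 → E3) : Prop :=
  ∀ ψ : 𝓓(Ω, ℝ), ∫ x, u x • gradient ψ x ∂(volOn Ω) = - ∫ x, ψ x • G x ∂(volOn Ω)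

lemma memLp_testFunction {Ω : Opens E3} {n : ℕ∞} (ψ : 𝓓^{n}(Ω, ℝ)) (p : ℝ≥0∞)
    (μ : Measure E3) [IsFiniteMeasureOnCompacts μ] : MemLp ψ p μ :=
  (map_continuous ψ).memLp_of_hasCompactSupport (TestFunctionClass.map_hasCompactSupport ψ)

lemma memLp_gradient {Ω : Opens E3} (ψ : 𝓓(Ω, ℝ)) (p : ℝ≥0∞)
    (μ : Measure E3) [IsFiniteMeasureOnCompacts μ] : MemLp (gradient ψ) p μ := by
  have h1 : ContDiff ℝ 1 (ψ : E3 → ℝ) :=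
    (TestFunctionClass.map_contDiff ψ).of_le (by exact_mod_cast le_top)
  have hc : Continuous (gradient (ψ : E3 → ℝ)) :=
    (InnerProductSpace.toDual ℝ E3).symm.continuous.comp (h1.continuous_fderiv one_ne_zero)
  have hs : HasCompactSupport (gradient (ψ : E3 → ℝ)) :=
    ((TestFunctionClass.map_hasCompactSupport ψ).fderiv ℝ).comp_left
      (g := (InnerProductSpace.toDual ℝ E3).symm) (map_zero _)
  exact hc.memLp_of_hasCompactSupport hs

/-- `H¹(Ω)`: the functions `u ∈ L²(Ω)` that have a weak gradient `∇u ∈ L²(Ω; ℝ³)`. Such a `u` is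
represented by the pair `(u, ∇u)`, so that `‖u‖²` is `∫_Ω |u|² + ∫_Ω |∇u|²`. -/
def SobolevH1 (Ω : Opens E3) : Submodule ℝ (L2Pair Ω) where
  carrier := {v | IsWeakGradient Ω v.fst v.snd}
  zero_mem' := by
    intro ψ
    have h1 : ∀ᵐ x ∂(volOn Ω), (0 : Lp ℝ 2 (volOn Ω)) x • gradient ψ x = 0 := by
      filter_upwards [Lp.coeFn_zero ℝ 2 (volOn Ω)] with x hx
      rw [hx, Pi.zero_apply, zero_smul]
    have h2 : ∀ᵐ x ∂(volOn Ω), ψ x • (0 : Lp E3 2 (volOn Ω)) x = 0 := by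
      filter_upwards [Lp.coeFn_zero E3 2 (volOn Ω)] with x hx
      rw [hx, Pi.zero_apply, smul_zero]
    change ∫ x, (0 : Lp ℝ 2 (volOn Ω)) x • gradient ψ x ∂(volOn Ω)
      = - ∫ x, ψ x • (0 : Lp E3 2 (volOn Ω)) x ∂(volOn Ω)
    rw [integral_congr_ae h1, integral_congr_ae h2]
    simp
  add_mem' := by
    intro v w hv hw ψ
    have h1 : ∀ᵐ x ∂(volOn Ω), (v + w).fst x • gradient ψ x
        = v.fst x • gradient ψ x + w.fst x • gradient ψ x := by
      filter_upwards [Lp.coeFn_add v.fst w.fst] with x hx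
      rw [WithLp.add_fst, hx, Pi.add_apply, add_smul]
    have h2 : ∀ᵐ x ∂(volOn Ω), ψ x • (v + w).snd x = ψ x • v.snd x + ψ x • w.snd x := by
      filter_upwards [Lp.coeFn_add v.snd w.snd] with x hx
      rw [WithLp.add_snd, hx, Pi.add_apply, smul_add]
    have i1 : ∀ u : Lp ℝ 2 (volOn Ω), Integrable (fun x => u x • gradient ψ x) (volOn Ω) :=
      fun u => memLp_one_iff_integrable.1 ((memLp_gradient ψ 2 _).smul (Lp.memLp u))
    have i2 : ∀ G : Lp E3 2 (volOn Ω), Integrable (fun x => ψ x • G x) (volOn Ω) :=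
      fun G => memLp_one_iff_integrable.1 ((Lp.memLp G).smul (memLp_testFunction ψ 2 _))
    rw [integral_congr_ae h1, integral_congr_ae h2, integral_add (i1 _) (i1 _),
      integral_add (i2 _) (i2 _), hv ψ, hw ψ, neg_add]
  smul_mem' := by
    intro c v hv ψ
    have h1 : ∀ᵐ x ∂(volOn Ω), (c • v).fst x • gradient ψ x = c • (v.fst x • gradient ψ x) := by
      filter_upwards [Lp.coeFn_smul c v.fst] with x hx
      rw [WithLp.smul_fst, hx, Pi.smul_apply, smul_assoc]
    have h2 : ∀ᵐ x ∂(volOn Ω), ψ x • (c • v).snd x = c • (ψ x • v.snd x) := by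
      filter_upwards [Lp.coeFn_smul c v.snd] with x hx
      rw [WithLp.smul_snd, hx, Pi.smul_apply, smul_comm]
    rw [integral_congr_ae h1, integral_congr_ae h2, integral_smul, integral_smul, hv ψ, smul_neg]

/-- `H₀¹(Ω)`: the closure in `H¹(Ω)` of (the span of) the test functions `φ ∈ 𝓓(Ω)`, that is, of
the pairs `(φ, ∇φ)`. -/
def SobolevH10 (Ω : Opens E3) : Submodule ℝ (SobolevH1 Ω) :=
  (Submodule.span ℝ {v : SobolevH1 Ω | ∃ φ : 𝓓(Ω, ℝ),
    v.1.fst =ᵐ[volOn Ω] φ ∧ v.1.snd =ᵐ[volOn Ω] gradient φ}).topologicalClosure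

/-- The inclusion `H₀¹(Ω) → L²(Ω)`, `φ ↦ φ`, which forgets the gradient. -/
def SobolevH10.toL2 (Ω : Opens E3) : SobolevH10 Ω →L[ℝ] Lp ℝ 2 (volOn Ω) :=
  (WithLp.fstL 2 ℝ (Lp ℝ 2 (volOn Ω)) (Lp E3 2 (volOn Ω))).comp
    ((SobolevH1 Ω).subtypeL.comp (SobolevH10 Ω).subtypeL)

lemma SobolevH10.toL2_apply {Ω : Opens E3} (φ : SobolevH10 Ω) :
    SobolevH10.toL2 Ω φ = φ.1.1.fst := rfl

/-- `H⁻¹(Ω)`: the space of continuous linear functionals on `H₀¹(Ω)`, with the operator norm. -/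
abbrev SobolevHMinus1 (Ω : Opens E3) : Type := StrongDual ℝ (SobolevH10 Ω)

lemma integrable_mul_Lp {Ω : Opens E3} (h : CcFun Ω) (u : Lp ℝ 2 (volOn Ω)) :
    Integrable (fun x => h x * u x) (volOn Ω) :=
  memLp_one_iff_integrable.1 ((Lp.memLp u).mul (memLp_testFunction h 2 _))

lemma norm_integral_mul_Lp_le {Ω : Opens E3} (A : Set E3) (h : CcFun Ω)
    (u : Lp ℝ 2 (volOn Ω)) :
    ‖∫ x in A, h x * u x ∂(volOn Ω)‖
      ≤ ‖(memLp_testFunction h 2 (volOn Ω)).norm.toLp‖ * ‖u‖ := by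
  have hh := (memLp_testFunction h 2 (volOn Ω)).norm
  have hu := (Lp.memLp u).norm
  have hin : inner ℝ (hh.toLp _) (hu.toLp _) = ∫ x, ‖h x * u x‖ ∂(volOn Ω) := by
    rw [L2.inner_def]
    refine integral_congr_ae ?_
    filter_upwards [hh.coeFn_toLp, hu.coeFn_toLp] with x hx hy
    rw [hx, hy, norm_mul]
    simp [mul_comm]
  have hn : ‖hu.toLp _‖ = ‖u‖ := by
    rw [Lp.norm_toLp, eLpNorm_norm, Lp.norm_def]
  calc ‖∫ x in A, h x * u x ∂(volOn Ω)‖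
      ≤ ∫ x in A, ‖h x * u x‖ ∂(volOn Ω) := norm_integral_le_integral_norm _
    _ ≤ ∫ x, ‖h x * u x‖ ∂(volOn Ω) :=
        setIntegral_le_integral (integrable_mul_Lp h u).norm
          (ae_of_all _ fun _ => norm_nonneg _)
    _ = inner ℝ (hh.toLp _) (hu.toLp _) := hin.symm
    _ ≤ ‖hh.toLp _‖ * ‖hu.toLp _‖ := real_inner_le_norm _ _
    _ = ‖hh.toLp _‖ * ‖u‖ := by rw [hn]

/-- The functional `u ↦ ∫_{A ∩ Ω} h u dx` on `L²(Ω)`, for `h ∈ C_c(Ω)`. -/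
def integralL2 (Ω : Opens E3) (A : Set E3) (h : CcFun Ω) : StrongDual ℝ (Lp ℝ 2 (volOn Ω)) :=
  LinearMap.mkContinuous
    { toFun := fun u => ∫ x in A, h x * u x ∂(volOn Ω)
      map_add' := by
        intro u v
        rw [← integral_add (integrable_mul_Lp h u).restrict (integrable_mul_Lp h v).restrict]
        refine integral_congr_ae (ae_restrict_of_ae ?_)
        filter_upwards [Lp.coeFn_add u v] with x hx
        rw [hx, Pi.add_apply, mul_add]
      map_smul' := by
        intro c u
        rw [RingHom.id_apply, ← integral_smul]
        refine integral_congr_ae (ae_restrict_of_ae ?_)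
        filter_upwards [Lp.coeFn_smul c u] with x hx
        rw [hx, Pi.smul_apply, smul_eq_mul, smul_eq_mul, mul_left_comm] }
    _ (norm_integral_mul_Lp_le A h)

/-- The functional `φ ↦ ∫_{A ∩ Ω} h φ dx` in `H⁻¹(Ω)`, for `h ∈ C_c(Ω)`. -/
def integralFunctional (Ω : Opens E3) (A : Set E3) (h : CcFun Ω) : SobolevHMinus1 Ω :=
  (integralL2 Ω A h).comp (SobolevH10.toL2 Ω)

lemma integralFunctional_apply (Ω : Opens E3) (A : Set E3) (h : CcFun Ω) (φ : SobolevH10 Ω) :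
    integralFunctional Ω A h φ = ∫ x in A, h x * SobolevH10.toL2 Ω φ x ∂(volOn Ω) := rfl

/-! ### The periodic suspension -/

/-- The point `k ∈ ℤ³` of the unit lattice. -/
def latticePoint (k : Fin 3 → ℤ) : E3 := WithLp.toLp 2 fun i => (k i : ℝ)

/-- The unit cell `Y = (-1/2, 1/2)³`. -/
def unitCell : Set E3 := {y | ∀ i, y i ∈ Set.Ioo (-(1 / 2) : ℝ) (1 / 2)}

/-- The cell `Y_ε^k = εk + εY`. -/
def cell (ε : ℝ) (k : Fin 3 → ℤ) : Set E3 := (fun y => ε • latticePoint k + ε • y) '' unitCell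

/-- `ℤ_ε`: the indices of the cells contained in `Ω`. -/
def cellIndices (Ω : Opens E3) (ε : ℝ) : Set (Fin 3 → ℤ) := {k | cell ε k ⊆ (Ω : Set E3)}

/-- The suspensions `T_ε`: the union over `k ∈ ℤ_ε` of the balls `B(εk, ρ)`, where `ρ = r_ε`. -/
def suspensions (Ω : Opens E3) (ε ρ : ℝ) : Set E3 :=
  ⋃ k ∈ cellIndices Ω ε, Metric.ball (ε • latticePoint k) ρ

/-- The fluid domain `Ω_ε = Ω \ T_ε`. -/
def fluidDomain (Ω : Opens E3) (ε ρ : ℝ) : Set E3 := (Ω : Set E3) \ suspensions Ω ε ρ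

/-- `F_ε(φ) = ∫_{Ω_ε} f φ dx + b (ε / r_ε)³ ∫_{T_ε} g φ dx`, where `ρ = r_ε`. -/
def heatSource (Ω : Opens E3) (b : ℝ) (f g : CcFun Ω) (ε ρ : ℝ) : SobolevHMinus1 Ω :=
  integralFunctional Ω (fluidDomain Ω ε ρ) f
    + (b * (ε / ρ) ^ 3) • integralFunctional Ω (suspensions Ω ε ρ) g

/-- `F(φ) = ∫_Ω f φ dx + (4πb/3) ∫_Ω g φ dx`. -/
def limitHeatSource (Ω : Opens E3) (b : ℝ) (f g : CcFun Ω) : SobolevHMinus1 Ω :=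
  integralFunctional Ω Ω f + (4 * Real.pi * b / 3) • integralFunctional Ω Ω g

lemma heatSource_apply (Ω : Opens E3) (b : ℝ) (f g : CcFun Ω) (ε ρ : ℝ) (φ : SobolevH10 Ω) :
    heatSource Ω b f g ε ρ φ
      = ∫ x in fluidDomain Ω ε ρ, f x * SobolevH10.toL2 Ω φ x ∂(volOn Ω)
        + b * (ε / ρ) ^ 3 * ∫ x in suspensions Ω ε ρ, g x * SobolevH10.toL2 Ω φ x ∂(volOn Ω) :=
  rfl

lemma limitHeatSource_apply (Ω : Opens E3) (b : ℝ) (f g : CcFun Ω) (φ : SobolevH10 Ω) :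
    limitHeatSource Ω b f g φ
      = ∫ x, f x * SobolevH10.toL2 Ω φ x ∂(volOn Ω)
        + 4 * Real.pi * b / 3 * ∫ x, g x * SobolevH10.toL2 Ω φ x ∂(volOn Ω) := by
  have h : (volOn Ω).restrict (Ω : Set E3) = volOn Ω := by
    rw [Measure.restrict_restrict_of_subset subset_rfl]
  change ∫ x in (Ω : Set E3), f x * SobolevH10.toL2 Ω φ x ∂(volOn Ω)
    + 4 * Real.pi * b / 3 * ∫ x in (Ω : Set E3), g x * SobolevH10.toL2 Ω φ x ∂(volOn Ω) = _
  rw [h]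

end

/-! Since `H₀¹(Ω)` is a Hilbert space, weak convergence in its dual is convergence on each fixed `φ`
(`tendsto_toWeakSpace_strongDual`). The `f` term converges because the total volume of the balls is
O((r/ε)³), which tends to 0. For the `g` term tested against a smooth `φ`, the function gφ is
uniformly continuous, so (ε/r)³ times its integral over a ball and 4π/3 times its integral over the
surrounding cell are both close to (4π/3) ε³ (gφ)(εk), and the sum over k converges
(`tendsto_integral_suspensions`).

Passing from test functions to their closure requires the functionals (ε/r)³ ∫_{T_ε} gφ to be
bounded in the H¹ norm uniformly in ε, although the weight blows up. This is where the critical size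
r ~ ε³ enters. Along rays, the mean of |φ| over B(εk, r) exceeds the mean over B(εk, ε/2) by at most
the integral over s from r to ε/2 of the mean of |∇φ| over B(εk, s). A weighted Young inequality
bounds that excess by a constant plus a multiple of r⁻¹ times the Dirichlet energy in the larger
ball (`mean_ball_le_mean_ball_add`). After multiplication by ε³ and summation over the disjoint
balls, the energy carries the factor ε³/r, which stays bounded because r/ε³ has a positive limit
(`integral_abs_suspensions_le`). Density then concludes (`tendsto_apply_of_mem_topologicalClosure`).
-/

/-! ### Means over concentric balls -/

open scoped Pointwise in
/-- Change of variables from a ball to the unit ball. -/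
lemma setIntegral_ball_eq_unit (F : E3 → ℝ) (z : E3) {s : ℝ} (hs : 0 < s) :
    ∫ x in Metric.ball z s, F x = s ^ 3 * ∫ y in Metric.ball (0 : E3) 1, F (z + s • y) := by
  have h1 := Measure.setIntegral_comp_smul_of_pos volume (fun x => F (z + x))
    (Metric.ball (0 : E3) 1) hs
  have h2 : s • Metric.ball (0 : E3) 1 = Metric.ball 0 s := by
    rw [smul_unitBall_of_pos hs]
  rw [h2, finrank_euclideanSpace_fin] at h1
  have h3 : (fun x => z + x) ⁻¹' Metric.ball z s = Metric.ball (0 : E3) s := by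
    ext x; simp
  have h4 := (measurePreserving_add_left (volume : Measure E3) z).setIntegral_preimage_emb
    (measurableEmbedding_addLeft z) F (Metric.ball z s)
  rw [h1, ← h4, h3, smul_eq_mul, mul_inv_cancel_left₀ (pow_ne_zero _ hs.ne')]

lemma volume_real_ball (z : E3) {s : ℝ} (hs : 0 ≤ s) :
    volume.real (Metric.ball z s) = 4 * Real.pi / 3 * s ^ 3 := by
  rw [measureReal_def, EuclideanSpace.volume_ball_fin_three, ENNReal.toReal_mul,
    ENNReal.toReal_pow, ENNReal.toReal_ofReal hs, ENNReal.toReal_ofReal (by positivity)]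
  ring

lemma integrable_ball_of_continuous {F : E3 → ℝ} (hF : Continuous F) (z : E3) (s : ℝ) :
    IntegrableOn F (Metric.ball z s) :=
  (hF.continuousOn.integrableOn_compact (isCompact_closedBall z s)).mono_set
    Metric.ball_subset_closedBall

/-- Fundamental theorem of calculus along a ray. -/
lemma abs_le_abs_add_integral_fderiv {φ : E3 → ℝ} (hφ : ContDiff ℝ 1 φ) (z y : E3)
    (hy : ‖y‖ ≤ 1) {r R : ℝ} (hR : r ≤ R) :
    |φ (z + r • y)| ≤ |φ (z + R • y)| + ∫ s in r..R, ‖fderiv ℝ φ (z + s • y)‖ := by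
  have hc : Continuous (fderiv ℝ φ) := hφ.continuous_fderiv one_ne_zero
  have hd : ∀ s ∈ Set.uIcc r R, HasDerivAt (fun s : ℝ => φ (z + s • y))
      (fderiv ℝ φ (z + s • y) y) s := by
    intro s _
    have h1 : HasDerivAt (fun s : ℝ => z + s • y) y s := by
      simpa using ((hasDerivAt_id s).smul_const y).const_add z
    exact ((hφ.differentiable one_ne_zero _).hasFDerivAt).comp_hasDerivAt s h1
  have hcl : Continuous fun s : ℝ => fderiv ℝ φ (z + s • y) :=
    hc.comp (by fun_prop)
  have hftc := intervalIntegral.integral_eq_sub_of_hasDerivAt hd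
    ((hcl.clm_apply continuous_const).intervalIntegrable _ _)
  have hb : |∫ s in r..R, fderiv ℝ φ (z + s • y) y| ≤
      ∫ s in r..R, ‖fderiv ℝ φ (z + s • y)‖ := by
    refine (intervalIntegral.abs_integral_le_integral_abs hR).trans ?_
    refine intervalIntegral.integral_mono_on hR
      ((hcl.clm_apply continuous_const).abs.intervalIntegrable _ _)
      (hcl.norm.intervalIntegrable _ _) fun s _ => ?_
    calc |fderiv ℝ φ (z + s • y) y| ≤ ‖fderiv ℝ φ (z + s • y)‖ * ‖y‖ :=
          (fderiv ℝ φ (z + s • y)).le_opNorm y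
      _ ≤ _ := mul_le_of_le_one_right (norm_nonneg _) hy
  rw [hftc] at hb
  have := abs_sub_abs_le_abs_sub (φ (z + r • y)) (φ (z + R • y))
  rw [abs_sub_comm] at this
  linarith

lemma integrable_prod_unitBall {F : ℝ → E3 → ℝ} (hF : Continuous (Function.uncurry F))
    (r R : ℝ) : Integrable (Function.uncurry F)
      ((volume.restrict (Set.uIoc r R)).prod (volume.restrict (Metric.ball (0 : E3) 1))) := by
  rw [Measure.prod_restrict]
  refine IntegrableOn.mono_set (t := Set.uIcc r R ×ˢ Metric.closedBall (0 : E3) 1) ?_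
    (Set.prod_mono Set.uIoc_subset_uIcc Metric.ball_subset_closedBall)
  exact hF.continuousOn.integrableOn_compact (isCompact_uIcc.prod (isCompact_closedBall _ _))

/-- Rescaling to the unit ball lets the same `y` parametrize every ball B(z, s), so the ray
inequality can be integrated in `y` and Fubini exchanges `s` and `y`. -/
lemma integral_unitBall_le_add_integral_fderiv {φ : E3 → ℝ} (hφ : ContDiff ℝ 1 φ) (z : E3)
    {r R : ℝ} (hR : r ≤ R) :
    ∫ y in Metric.ball (0 : E3) 1, |φ (z + r • y)| ≤
      (∫ y in Metric.ball (0 : E3) 1, |φ (z + R • y)|) +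
        ∫ s in r..R, ∫ y in Metric.ball (0 : E3) 1, ‖fderiv ℝ φ (z + s • y)‖ := by
  have hc : Continuous (fderiv ℝ φ) := hφ.continuous_fderiv one_ne_zero
  have hF : Continuous (Function.uncurry fun (s : ℝ) (y : E3) => ‖fderiv ℝ φ (z + s • y)‖) :=
    (hc.comp (by fun_prop : Continuous fun p : ℝ × E3 => z + p.1 • p.2)).norm
  have hint := integrable_prod_unitBall hF r R
  have hcφ : ∀ s : ℝ, Continuous fun y : E3 => |φ (z + s • y)| := fun s =>
    (hφ.continuous.comp (by fun_prop)).abs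
  have hint2 : IntegrableOn (fun y => ∫ s in r..R, ‖fderiv ℝ φ (z + s • y)‖)
      (Metric.ball (0 : E3) 1) := by
    simp_rw [intervalIntegral.integral_of_le hR, ← Set.uIoc_of_le hR]
    exact hint.integral_prod_right
  rw [intervalIntegral_integral_swap hint,
    ← integral_add (integrable_ball_of_continuous (hcφ R) _ _) hint2]
  refine setIntegral_mono_on (integrable_ball_of_continuous (hcφ r) _ _)
    ((integrable_ball_of_continuous (hcφ R) _ _).add hint2) measurableSet_ball fun y hy => ?_
  exact abs_le_abs_add_integral_fderiv hφ z y (by simpa using (Metric.mem_ball.1 hy).le) hR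

/-- The singularity at the lower end dominates, so the bound does not depend on `R`. -/
lemma integral_rpow_neg_three_halves_le {r R : ℝ} (hr : 0 < r) (hR : r ≤ R) :
    ∫ s in r..R, s ^ (-(3 / 2) : ℝ) ≤ 2 * r ^ (-(1 / 2) : ℝ) := by
  rw [integral_rpow (Or.inr ⟨by norm_num, by
    rw [Set.uIcc_of_le hR]; exact fun h => absurd h.1 (not_le.2 hr)⟩)]
  have h : (-(3 / 2) + 1 : ℝ) = -(1 / 2) := by norm_num
  have h2 : 0 ≤ R ^ (-(1 / 2) : ℝ) := Real.rpow_nonneg (hr.le.trans hR) _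
  rw [h]
  linarith

/-- The mean of `‖∇φ‖` over `B(z, s)`, by weighted Young inequality. -/
lemma integral_unitBall_fderiv_le {φ : E3 → ℝ} (hφ : ContDiff ℝ 1 φ) (z : E3)
    {r s R : ℝ} (hr : 0 < r) (hrs : r ≤ s) (hsR : s ≤ R) :
    ∫ y in Metric.ball (0 : E3) 1, ‖fderiv ℝ φ (z + s • y)‖ ≤
      s ^ (-(3 / 2) : ℝ) * (1 / 2 * (4 * Real.pi / 3 * r ^ (1 / 2 : ℝ)
        + r ^ (-(1 / 2) : ℝ) * ∫ x in Metric.ball z R, ‖fderiv ℝ φ x‖ ^ 2)) := by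
  have hs : 0 < s := hr.trans_le hrs
  have hc : Continuous (fderiv ℝ φ) := hφ.continuous_fderiv one_ne_zero
  have hcs : Continuous fun y : E3 => fderiv ℝ φ (z + s • y) := hc.comp (by fun_prop)
  -- Young's weight is p q. The exponent -3/2 gives q⁻¹ s⁻³ = q, so both Young terms decay in `s`
  -- like q; p = √r balances the factor r^(-1/2) produced by the integral of q over [r, R].
  set p : ℝ := r ^ (1 / 2 : ℝ) with hp
  set q : ℝ := s ^ (-(3 / 2) : ℝ) with hq
  have hp0 : 0 < p := Real.rpow_pos_of_pos hr _
  have hq0 : 0 < q := Real.rpow_pos_of_pos hs _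
  have hpi : r ^ (-(1 / 2) : ℝ) = p⁻¹ := Real.rpow_neg hr.le _
  have hqq : q ^ 2 = (s ^ 3)⁻¹ := by
    rw [hq, ← Real.rpow_natCast, ← Real.rpow_mul hs.le, ← Real.rpow_natCast, ← Real.rpow_neg hs.le]
    norm_num
  have hqi : (s ^ 3)⁻¹ * q⁻¹ = q := by
    rw [← hqq]; field_simp
  have hyoung : ∀ y : E3, ‖fderiv ℝ φ (z + s • y)‖ ≤
      1 / 2 * (p * q) + 1 / 2 * (p⁻¹ * q⁻¹) * ‖fderiv ℝ φ (z + s • y)‖ ^ 2 := by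
    intro y
    set a := ‖fderiv ℝ φ (z + s • y)‖
    have h : 1 / 2 * (p * q) + 1 / 2 * (p⁻¹ * q⁻¹) * a ^ 2 - a
        = 1 / 2 * (p⁻¹ * q⁻¹) * (a - p * q) ^ 2 := by
      field_simp; ring
    have : 0 ≤ 1 / 2 * (p⁻¹ * q⁻¹) * (a - p * q) ^ 2 := by positivity
    linarith
  have hi2 : IntegrableOn (fun y : E3 => 1 / 2 * (p⁻¹ * q⁻¹) * ‖fderiv ℝ φ (z + s • y)‖ ^ 2)
      (Metric.ball 0 1) := integrable_ball_of_continuous (by fun_prop) _ _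
  have hi1 : IntegrableOn (fun _ : E3 => 1 / 2 * (p * q)) (Metric.ball 0 1) :=
    integrable_ball_of_continuous continuous_const _ _
  have hball : ∫ x in Metric.ball z s, ‖fderiv ℝ φ x‖ ^ 2 ≤
      ∫ x in Metric.ball z R, ‖fderiv ℝ φ x‖ ^ 2 :=
    setIntegral_mono_set (integrable_ball_of_continuous (by fun_prop) _ _)
      (ae_of_all _ fun _ => by positivity)
      (Metric.ball_subset_ball hsR).eventuallyLE
  have hcv := setIntegral_ball_eq_unit (fun x => ‖fderiv ℝ φ x‖ ^ 2) z hs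
  have hcv' : ∫ y in Metric.ball (0 : E3) 1, ‖fderiv ℝ φ (z + s • y)‖ ^ 2
      = (s ^ 3)⁻¹ * ∫ x in Metric.ball z s, ‖fderiv ℝ φ x‖ ^ 2 := by
    rw [hcv, inv_mul_cancel_left₀ (pow_ne_zero _ hs.ne')]
  calc ∫ y in Metric.ball (0 : E3) 1, ‖fderiv ℝ φ (z + s • y)‖
      ≤ ∫ y in Metric.ball (0 : E3) 1, (1 / 2 * (p * q) +
          1 / 2 * (p⁻¹ * q⁻¹) * ‖fderiv ℝ φ (z + s • y)‖ ^ 2) :=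
        integral_mono (integrable_ball_of_continuous hcs.norm _ _)
          (Integrable.add hi1 hi2) hyoung
    _ = 4 * Real.pi / 3 * (1 / 2 * (p * q)) + 1 / 2 * (p⁻¹ * q⁻¹) * ((s ^ 3)⁻¹ *
          ∫ x in Metric.ball z s, ‖fderiv ℝ φ x‖ ^ 2) := by
        rw [integral_add hi1 hi2, setIntegral_const, integral_const_mul (1 / 2 * (p⁻¹ * q⁻¹)), hcv',
          volume_real_ball _ zero_le_one]
        simp
    _ = 4 * Real.pi / 3 * (1 / 2 * (p * q)) + 1 / 2 * p⁻¹ * q *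
          ∫ x in Metric.ball z s, ‖fderiv ℝ φ x‖ ^ 2 := by
        have h : 1 / 2 * p⁻¹ * q = 1 / 2 * p⁻¹ * ((s ^ 3)⁻¹ * q⁻¹) := by rw [hqi]
        rw [h]; ring
    _ ≤ 4 * Real.pi / 3 * (1 / 2 * (p * q)) + 1 / 2 * p⁻¹ * q *
          ∫ x in Metric.ball z R, ‖fderiv ℝ φ x‖ ^ 2 := by gcongr
    _ = _ := by rw [hpi]; ring

/-- Comparison of the means of `|φ|` on two concentric balls. The term in `∇φ` scales like the
inverse of the capacity of the small ball. -/
lemma mean_ball_le_mean_ball_add {φ : E3 → ℝ} (hφ : ContDiff ℝ 1 φ) (z : E3)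
    {r R : ℝ} (hr : 0 < r) (hR : r ≤ R) :
    (r ^ 3)⁻¹ * ∫ x in Metric.ball z r, |φ x| ≤
      (R ^ 3)⁻¹ * (∫ x in Metric.ball z R, |φ x|) + 4 * Real.pi / 3
        + r⁻¹ * ∫ x in Metric.ball z R, ‖fderiv ℝ φ x‖ ^ 2 := by
  have hR0 := hr.trans_le hR
  rw [setIntegral_ball_eq_unit _ z hr, setIntegral_ball_eq_unit _ z hR0,
    inv_mul_cancel_left₀ (pow_ne_zero _ hr.ne'), inv_mul_cancel_left₀ (pow_ne_zero _ hR0.ne')]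
  have hc : Continuous (fderiv ℝ φ) := hφ.continuous_fderiv one_ne_zero
  have hF : Continuous (Function.uncurry fun (s : ℝ) (y : E3) => ‖fderiv ℝ φ (z + s • y)‖) :=
    (hc.comp (by fun_prop : Continuous fun p : ℝ × E3 => z + p.1 • p.2)).norm
  have h1 := integral_unitBall_le_add_integral_fderiv hφ z hR
  set G := ∫ x in Metric.ball z R, ‖fderiv ℝ φ x‖ ^ 2 with hG
  have hG0 : 0 ≤ G := integral_nonneg fun _ => by positivity
  have hp0 : 0 < r ^ (1 / 2 : ℝ) := Real.rpow_pos_of_pos hr _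
  have hpi : r ^ (-(1 / 2) : ℝ) = (r ^ (1 / 2 : ℝ))⁻¹ := Real.rpow_neg hr.le _
  have hpp : r ^ (1 / 2 : ℝ) * r ^ (1 / 2 : ℝ) = r := by
    rw [← Real.rpow_add hr]; norm_num
  have h2 : ∫ s in r..R, ∫ y in Metric.ball (0 : E3) 1, ‖fderiv ℝ φ (z + s • y)‖ ≤
      ∫ s in r..R, s ^ (-(3 / 2) : ℝ) * (1 / 2 * (4 * Real.pi / 3 * r ^ (1 / 2 : ℝ)
        + r ^ (-(1 / 2) : ℝ) * G)) := by
    refine intervalIntegral.integral_mono_on hR ?_ ?_ fun s hs =>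
      integral_unitBall_fderiv_le hφ z hr hs.1 hs.2
    · rw [intervalIntegrable_iff]
      exact (integrable_prod_unitBall hF r R).integral_prod_left
    · refine (intervalIntegral.intervalIntegrable_rpow (Or.inr ?_)).mul_const _
      rw [Set.uIcc_of_le hR]
      exact fun h => absurd h.1 (not_le.2 hr)
  have h3 : ∫ s in r..R, s ^ (-(3 / 2) : ℝ) * (1 / 2 * (4 * Real.pi / 3 * r ^ (1 / 2 : ℝ)
        + r ^ (-(1 / 2) : ℝ) * G)) ≤ 4 * Real.pi / 3 + r⁻¹ * G := by
    rw [intervalIntegral.integral_mul_const]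
    calc _ ≤ 2 * r ^ (-(1 / 2) : ℝ) * (1 / 2 * (4 * Real.pi / 3 * r ^ (1 / 2 : ℝ)
        + r ^ (-(1 / 2) : ℝ) * G)) := by
          refine mul_le_mul_of_nonneg_right (integral_rpow_neg_three_halves_le hr hR) ?_
          have := Real.pi_pos
          have : 0 ≤ r ^ (-(1 / 2) : ℝ) := Real.rpow_nonneg hr.le _
          positivity
      _ = 4 * Real.pi / 3 + r⁻¹ * G := by
          rw [hpi]
          -- The fourth occurrence of `r` is the one in `r⁻¹`.
          nth_rewrite 4 [← hpp]
          field_simp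
  linarith

/-! ### Cells, their number, and the volume of the suspensions -/

lemma latticePoint_apply (k : Fin 3 → ℤ) (i : Fin 3) : latticePoint k i = (k i : ℝ) := rfl

lemma mem_cell_iff {ε : ℝ} (hε : 0 < ε) (k : Fin 3 → ℤ) (x : E3) :
    x ∈ cell ε k ↔ ∀ i, |x i - ε * k i| < ε / 2 := by
  constructor
  · rintro ⟨y, hy, rfl⟩ i
    have h := hy i
    have : (ε • latticePoint k + ε • y) i - ε * k i = ε * y i := by
      simp [latticePoint_apply]
    rw [this, abs_mul, abs_of_pos hε]
    have : |y i| < 1 / 2 := abs_lt.2 ⟨h.1, h.2⟩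
    nlinarith
  · intro h
    refine ⟨ε⁻¹ • (x - ε • latticePoint k), fun i => ?_, ?_⟩
    · have hi := abs_lt.1 (h i)
      have : (ε⁻¹ • (x - ε • latticePoint k)) i = (x i - ε * k i) / ε := by
        simp [latticePoint_apply, div_eq_inv_mul]
      rw [this]
      constructor
      · rw [lt_div_iff₀ hε]; linarith [hi.1]
      · rw [div_lt_iff₀ hε]; linarith [hi.2]
    · simp [smul_smul, hε.ne']

lemma ball_subset_cell {ε ρ : ℝ} (hε : 0 < ε) (hρ : ρ ≤ ε / 2) (k : Fin 3 → ℤ) :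
    Metric.ball (ε • latticePoint k) ρ ⊆ cell ε k := by
  intro x hx
  rw [mem_cell_iff hε]
  intro i
  have h1 : |(x - ε • latticePoint k) i| ≤ ‖x - ε • latticePoint k‖ := by
    simpa using PiLp.norm_apply_le (x - ε • latticePoint k) i
  have h2 : (x - ε • latticePoint k) i = x i - ε * k i := by simp [latticePoint_apply]
  rw [h2] at h1
  exact h1.trans_lt ((mem_ball_iff_norm.1 hx).trans_le hρ)

lemma disjoint_cell {ε : ℝ} (hε : 0 < ε) {k l : Fin 3 → ℤ} (hkl : k ≠ l) :
    Disjoint (cell ε k) (cell ε l) := by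
  rw [Set.disjoint_left]
  intro x hk hl
  rw [mem_cell_iff hε] at hk hl
  refine hkl (funext fun i => ?_)
  have h1 := abs_lt.1 (hk i)
  have h2 := abs_lt.1 (hl i)
  have h3 : (k i : ℝ) < l i + 1 := by
    have : ε * k i < ε * (l i + 1) := by linarith [h1.1, h2.2]
    exact lt_of_mul_lt_mul_left this hε.le
  have h4 : (l i : ℝ) < k i + 1 := by
    have : ε * l i < ε * (k i + 1) := by linarith [h1.2, h2.1]
    exact lt_of_mul_lt_mul_left this hε.le
  have h5 : k i < l i + 1 := by exact_mod_cast h3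
  have h6 : l i < k i + 1 := by exact_mod_cast h4
  omega

lemma disjoint_lattice_balls {ε ρ : ℝ} (hε : 0 < ε) (hρ : ρ ≤ ε / 2) {k l : Fin 3 → ℤ}
    (hkl : k ≠ l) :
    Disjoint (Metric.ball (ε • latticePoint k) ρ) (Metric.ball (ε • latticePoint l) ρ) :=
  (disjoint_cell hε hkl).mono (ball_subset_cell hε hρ k) (ball_subset_cell hε hρ l)

lemma volume_ne_top_of_isBounded {Ω : Opens E3} (hΩ : Bornology.IsBounded (Ω : Set E3)) :
    volume (Ω : Set E3) ≠ ∞ := hΩ.measure_lt_top.ne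

/-- The inscribed balls of radius ε/2 are disjoint, have equal positive volume and lie in a set of
finite volume. -/
lemma finite_cellIndices {Ω : Opens E3} (hΩ : Bornology.IsBounded (Ω : Set E3)) {ε : ℝ}
    (hε : 0 < ε) : (cellIndices Ω ε).Finite := by
  have hsub : (⋃ k : cellIndices Ω ε, Metric.ball (ε • latticePoint k.1) (ε / 2))
      ⊆ (Ω : Set E3) :=
    Set.iUnion_subset fun k => (ball_subset_cell hε le_rfl k.1).trans k.2
  have hpos : 0 < volume (Metric.ball (0 : E3) (ε / 2)) :=
    Metric.measure_ball_pos _ _ (by positivity)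
  have h := Measure.finite_const_le_meas_of_disjoint_iUnion (volume : Measure E3) hpos
    (As := fun k : cellIndices Ω ε => Metric.ball (ε • latticePoint k.1) (ε / 2))
    (fun k => measurableSet_ball)
    (fun k l hkl => disjoint_lattice_balls hε le_rfl fun h => hkl (Subtype.ext h))
    (ne_top_of_le_ne_top (volume_ne_top_of_isBounded hΩ) (measure_mono hsub))
  have huniv : {i : cellIndices Ω ε | volume (Metric.ball (0 : E3) (ε / 2)) ≤
      volume (Metric.ball (ε • latticePoint i.1) (ε / 2))} = Set.univ := by
    ext i
    simp [Measure.addHaar_ball_center]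
  rw [huniv] at h
  exact Set.finite_coe_iff.1 (Set.finite_univ_iff.1 h)

lemma suspensions_subset {Ω : Opens E3} {ε ρ : ℝ} (hε : 0 < ε) (hρ : ρ ≤ ε / 2) :
    suspensions Ω ε ρ ⊆ Ω :=
  Set.iUnion₂_subset fun k hk => (ball_subset_cell hε hρ k).trans hk

lemma isOpen_suspensions (Ω : Opens E3) (ε ρ : ℝ) : IsOpen (suspensions Ω ε ρ) :=
  isOpen_biUnion fun _ _ => Metric.isOpen_ball

lemma setIntegral_suspensions {Ω : Opens E3} (hΩ : Bornology.IsBounded (Ω : Set E3)) {ε ρ : ℝ}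
    (hε : 0 < ε) (hρ : ρ ≤ ε / 2) {F : E3 → ℝ} (hF : IntegrableOn F Ω) :
    ∫ x in suspensions Ω ε ρ, F x =
      ∑ k ∈ (finite_cellIndices hΩ hε).toFinset,
        ∫ x in Metric.ball (ε • latticePoint k) ρ, F x := by
  rw [← integral_biUnion_finset]
  · simp [suspensions]
  · exact fun _ _ => measurableSet_ball
  · exact fun k _ l _ hkl => disjoint_lattice_balls hε hρ hkl
  · intro k hk
    have hk' : k ∈ cellIndices Ω ε := by simpa using hk
    exact hF.mono_set ((ball_subset_cell hε hρ k).trans hk')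

lemma sum_setIntegral_ball_le {Ω : Opens E3} (hΩ : Bornology.IsBounded (Ω : Set E3)) {ε ρ : ℝ}
    (hε : 0 < ε) (hρ : ρ ≤ ε / 2) {F : E3 → ℝ} (hF : IntegrableOn F Ω) (hF0 : ∀ x, 0 ≤ F x) :
    ∑ k ∈ (finite_cellIndices hΩ hε).toFinset,
        ∫ x in Metric.ball (ε • latticePoint k) ρ, F x ≤ ∫ x in Ω, F x := by
  rw [← setIntegral_suspensions hΩ hε hρ hF]
  exact setIntegral_mono_set hF (ae_of_all _ hF0) (suspensions_subset hε hρ).eventuallyLE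

/-- Volume count with the inscribed balls of radius ε/2; the 8 is 2³. -/
lemma card_cellIndices_mul_le {Ω : Opens E3} (hΩ : Bornology.IsBounded (Ω : Set E3)) {ε : ℝ}
    (hε : 0 < ε) : (finite_cellIndices hΩ hε).toFinset.card * (4 * Real.pi / 3 * ε ^ 3) ≤
      8 * volume.real (Ω : Set E3) := by
  have h := sum_setIntegral_ball_le hΩ hε le_rfl (F := fun _ => 1)
    (integrableOn_const (volume_ne_top_of_isBounded hΩ)) (fun _ => zero_le_one)
  simp only [setIntegral_const, smul_eq_mul, mul_one,
    volume_real_ball _ (by positivity : 0 ≤ ε / 2), Finset.sum_const, nsmul_eq_mul] at h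
  linear_combination 8 * h

lemma volume_real_suspensions_le {Ω : Opens E3} (hΩ : Bornology.IsBounded (Ω : Set E3))
    {ε ρ : ℝ} (hε : 0 < ε) (hρ0 : 0 ≤ ρ) (hρ : ρ ≤ ε / 2) :
    volume.real (suspensions Ω ε ρ) ≤ 8 * volume.real (Ω : Set E3) * (ρ / ε) ^ 3 := by
  have h := setIntegral_suspensions hΩ hε hρ (F := fun _ => 1)
    (integrableOn_const (volume_ne_top_of_isBounded hΩ))
  simp only [setIntegral_const, smul_eq_mul, mul_one, volume_real_ball _ hρ0,
    Finset.sum_const, nsmul_eq_mul] at h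
  rw [h]
  calc _ = (finite_cellIndices hΩ hε).toFinset.card * (4 * Real.pi / 3 * ε ^ 3)
        * (ρ / ε) ^ 3 := by field_simp
    _ ≤ _ := mul_le_mul_of_nonneg_right (card_cellIndices_mul_le hΩ hε) (by positivity)

/-- The critical-size estimate: the `L¹` mass of a test function on the suspensions, rescaled by
their volume fraction, is controlled by its Sobolev norm. -/
lemma integral_abs_suspensions_le {Ω : Opens E3} (hΩ : Bornology.IsBounded (Ω : Set E3))
    {ε ρ : ℝ} (hρ0 : 0 < ρ) (hρ : ρ ≤ ε / 2) (φ : 𝓓(Ω, ℝ)) :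
    (ε / ρ) ^ 3 * ∫ x in suspensions Ω ε ρ, |φ x| ≤
      8 * (∫ x in Ω, |φ x|) + 8 * volume.real (Ω : Set E3)
        + ε ^ 3 / ρ * ∫ x in Ω, ‖fderiv ℝ φ x‖ ^ 2 := by
  have hε : 0 < ε := by linarith
  have h1 : ContDiff ℝ 1 (φ : E3 → ℝ) :=
    (TestFunctionClass.map_contDiff φ).of_le (by exact_mod_cast le_top)
  have hcK : IsCompact (closure (Ω : Set E3)) := hΩ.isCompact_closure
  have hcf : Continuous fun x => ‖fderiv ℝ φ x‖ ^ 2 := (h1.continuous_fderiv one_ne_zero).norm.pow 2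
  have hi1 : IntegrableOn (fun x => |φ x|) (Ω : Set E3) :=
    (h1.continuous.abs.continuousOn.integrableOn_compact hcK).mono_set subset_closure
  have hi2 : IntegrableOn (fun x => ‖fderiv ℝ φ x‖ ^ 2) (Ω : Set E3) :=
    (hcf.continuousOn.integrableOn_compact hcK).mono_set subset_closure
  have e1 := sum_setIntegral_ball_le hΩ hε le_rfl hi1 fun _ => abs_nonneg _
  have e2 := sum_setIntegral_ball_le hΩ hε le_rfl hi2 fun _ => by positivity
  have e3 := card_cellIndices_mul_le hΩ hε
  rw [setIntegral_suspensions hΩ hε hρ hi1, Finset.mul_sum]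
  calc ∑ k ∈ (finite_cellIndices hΩ hε).toFinset,
        (ε / ρ) ^ 3 * ∫ x in Metric.ball (ε • latticePoint k) ρ, |φ x|
      ≤ ∑ k ∈ (finite_cellIndices hΩ hε).toFinset,
        (8 * (∫ x in Metric.ball (ε • latticePoint k) (ε / 2), |φ x|) + 4 * Real.pi / 3 * ε ^ 3
        + ε ^ 3 / ρ * ∫ x in Metric.ball (ε • latticePoint k) (ε / 2), ‖fderiv ℝ φ x‖ ^ 2) := by
        refine Finset.sum_le_sum fun k _ => ?_
        -- Comparison with the inscribed ball R = ε/2, for which ε³ / R³ = 8.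
        have := mul_le_mul_of_nonneg_left
          (mean_ball_le_mean_ball_add h1 (ε • latticePoint k) hρ0 hρ) (by positivity : 0 ≤ ε ^ 3)
        calc _ = ε ^ 3 * ((ρ ^ 3)⁻¹ * ∫ x in Metric.ball (ε • latticePoint k) ρ, |φ x|) := by
              field_simp
          _ ≤ _ := this
          _ = _ := by field_simp; ring
    _ = 8 * (∑ k ∈ (finite_cellIndices hΩ hε).toFinset,
          ∫ x in Metric.ball (ε • latticePoint k) (ε / 2), |φ x|)
        + (finite_cellIndices hΩ hε).toFinset.card * (4 * Real.pi / 3 * ε ^ 3)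
        + ε ^ 3 / ρ * ∑ k ∈ (finite_cellIndices hΩ hε).toFinset,
          ∫ x in Metric.ball (ε • latticePoint k) (ε / 2), ‖fderiv ℝ φ x‖ ^ 2 := by
        rw [Finset.sum_add_distrib, Finset.sum_add_distrib, Finset.mul_sum, Finset.mul_sum,
          Finset.sum_const, nsmul_eq_mul]
    _ ≤ _ := by gcongr

/-! ### Riemann sums over half-open cells, which tile space exactly -/

/-- The half-open cell with centre `εk` and side `ε`. -/
def halfOpenCell (ε : ℝ) (k : Fin 3 → ℤ) : Set E3 :=
  {x | ∀ i, x i ∈ Set.Ico (ε * k i - ε / 2) (ε * k i + ε / 2)}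

lemma halfOpenCell_eq_preimage (ε : ℝ) (k : Fin 3 → ℤ) :
    halfOpenCell ε k = (MeasurableEquiv.toLp 2 (Fin 3 → ℝ)).symm ⁻¹'
      Set.univ.pi fun i => Set.Ico (ε * k i - ε / 2) (ε * k i + ε / 2) := by
  ext x
  simp only [halfOpenCell, Set.mem_preimage, Set.mem_univ_pi]
  rfl

lemma measurableSet_halfOpenCell (ε : ℝ) (k : Fin 3 → ℤ) : MeasurableSet (halfOpenCell ε k) := by
  rw [halfOpenCell_eq_preimage]
  exact (MeasurableEquiv.measurable _) (MeasurableSet.univ_pi fun _ => measurableSet_Ico)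

lemma volume_halfOpenCell (ε : ℝ) (k : Fin 3 → ℤ) :
    volume (halfOpenCell ε k) = ENNReal.ofReal ε ^ 3 := by
  rw [halfOpenCell_eq_preimage,
    (EuclideanSpace.volume_preserving_symm_measurableEquiv_toLp (Fin 3)).measure_preimage
      (MeasurableSet.univ_pi fun _ => measurableSet_Ico).nullMeasurableSet, volume_pi_pi]
  have : ∀ a : ℝ, a + ε / 2 - (a - ε / 2) = ε := fun a => by ring
  simp [this]

lemma disjoint_halfOpenCell {ε : ℝ} (hε : 0 < ε) {k l : Fin 3 → ℤ} (hkl : k ≠ l) :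
    Disjoint (halfOpenCell ε k) (halfOpenCell ε l) := by
  rw [Set.disjoint_left]
  intro x hk hl
  refine hkl (funext fun i => ?_)
  have h1 := hk i
  have h2 := hl i
  have h3 : (k i : ℝ) < l i + 1 := by
    have : ε * k i < ε * (l i + 1) := by linarith [h1.1, h2.2]
    exact lt_of_mul_lt_mul_left this hε.le
  have h4 : (l i : ℝ) < k i + 1 := by
    have : ε * l i < ε * (k i + 1) := by linarith [h1.2, h2.1]
    exact lt_of_mul_lt_mul_left this hε.le
  have h5 : k i < l i + 1 := by exact_mod_cast h3
  have h6 : l i < k i + 1 := by exact_mod_cast h4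
  omega

lemma exists_mem_halfOpenCell {ε : ℝ} (hε : 0 < ε) (x : E3) : ∃ k, x ∈ halfOpenCell ε k := by
  -- Cells are centred at lattice points, so the index is the nearest integer, with ties rounded up.
  refine ⟨fun i => ⌊x i / ε + 1 / 2⌋, fun i => ?_⟩
  have h1 := Int.floor_le (x i / ε + 1 / 2)
  have h2 := Int.lt_floor_add_one (x i / ε + 1 / 2)
  have h3 : ε * (x i / ε) = x i := by field_simp
  constructor <;> nlinarith

/-- The half-diagonal of the cube is (√3/2) ε < ε. -/
lemma dist_lt_of_forall_abs_le {ε : ℝ} (hε : 0 < ε) {x : E3} {k : Fin 3 → ℤ}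
    (h : ∀ i, |x i - ε * k i| ≤ ε / 2) : dist x (ε • latticePoint k) < ε := by
  rw [EuclideanSpace.dist_eq, Real.sqrt_lt' hε]
  have h2 : ∀ i, dist (x i) ((ε • latticePoint k) i) ^ 2 ≤ (ε / 2) ^ 2 := by
    intro i
    rw [Real.dist_eq]
    have : (ε • latticePoint k) i = ε * k i := by simp [latticePoint_apply]
    rw [this]
    exact pow_le_pow_left₀ (abs_nonneg _) (h i) 2
  calc _ ≤ ∑ i : Fin 3, (ε / 2) ^ 2 := Finset.sum_le_sum fun i _ => h2 i
    _ < ε ^ 2 := by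
      simp only [Finset.sum_const, Finset.card_univ, Fintype.card_fin, nsmul_eq_mul]
      push_cast
      nlinarith [pow_pos hε 2]

lemma halfOpenCell_subset_ball {ε : ℝ} (hε : 0 < ε) (k : Fin 3 → ℤ) :
    halfOpenCell ε k ⊆ Metric.ball (ε • latticePoint k) ε := fun x hx =>
  dist_lt_of_forall_abs_le hε fun i => abs_le.2
    ⟨by linarith [(hx i).1], by linarith [(hx i).2]⟩

lemma cell_subset_ball {ε : ℝ} (hε : 0 < ε) (k : Fin 3 → ℤ) :
    cell ε k ⊆ Metric.ball (ε • latticePoint k) ε := fun x hx =>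
  dist_lt_of_forall_abs_le hε fun i => ((mem_cell_iff hε k x).1 hx i).le

/-- For small `ε`, the cells contained in `Ω` carry the whole integral of a function with compact
support in `Ω`. -/
lemma eventually_integral_eq_sum_halfOpenCell {Ω : Opens E3}
    (hΩ : Bornology.IsBounded (Ω : Set E3)) {h : E3 → ℝ} (hc : Continuous h)
    (hs : HasCompactSupport h) (hsΩ : tsupport h ⊆ Ω) :
    ∃ δ > 0, ∀ ε, ∀ hε : 0 < ε, ε < δ →
      ∫ x in Ω, h x = ∑ k ∈ (finite_cellIndices hΩ hε).toFinset, ∫ x in halfOpenCell ε k, h x := by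
  obtain ⟨δ, hδ, hsub⟩ := IsCompact.exists_thickening_subset_open hs Ω.isOpen hsΩ
  -- Two points of one cell are within ε of its centre, hence at distance less than 2ε < δ. A cell
  -- whose half-open version meets the support therefore lies in Ω.
  refine ⟨δ / 2, by positivity, fun ε hε hεδ => ?_⟩
  rw [← integral_biUnion_finset _ (fun k _ => measurableSet_halfOpenCell ε k)
    (fun k _ l _ hkl => disjoint_halfOpenCell hε hkl)
    (fun k _ => (hc.integrable_of_hasCompactSupport hs).integrableOn),
    setIntegral_eq_integral_of_forall_compl_eq_zero
      (fun x hx => image_eq_zero_of_notMem_tsupport fun hx' => hx (hsΩ hx')),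
    setIntegral_eq_integral_of_forall_compl_eq_zero]
  intro x hx
  by_contra hne
  obtain ⟨k, hk⟩ := exists_mem_halfOpenCell hε x
  refine hx (Set.mem_biUnion (x := k) ?_ hk)
  rw [Finset.mem_coe, Set.Finite.mem_toFinset]
  intro y hy
  refine hsub (Metric.mem_thickening_iff.2 ⟨x, subset_tsupport _ hne, ?_⟩)
  have h1 := Metric.mem_ball.1 (halfOpenCell_subset_ball hε k hk)
  have h2 := Metric.mem_ball.1 (cell_subset_ball hε k hy)
  linarith [dist_triangle_right y x (ε • latticePoint k)]

lemma abs_setIntegral_sub_le {h : E3 → ℝ} {A : Set E3} {c : E3} {η : ℝ} (hi : IntegrableOn h A)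
    (hA : volume A < ∞) (hη : ∀ x ∈ A, |h x - h c| ≤ η) :
    |(∫ x in A, h x) - volume.real A * h c| ≤ η * volume.real A := by
  have h1 : (∫ x in A, h x) - volume.real A * h c = ∫ x in A, (h x - h c) := by
    rw [integral_sub hi (integrableOn_const hA.ne), setIntegral_const, smul_eq_mul]
  rw [h1]
  exact norm_setIntegral_le_of_norm_le_const (f := fun x => h x - h c) hA hη

/-- Convergence of the rescaled integrals over the suspensions, for continuous functions. -/
lemma tendsto_integral_suspensions {Ω : Opens E3} (hΩ : Bornology.IsBounded (Ω : Set E3))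
    {h : E3 → ℝ} (hc : Continuous h) (hs : HasCompactSupport h) (hsΩ : tsupport h ⊆ Ω)
    {r : ℝ → ℝ} (hr : ∀ ε, 0 < ε → 0 < r ε) (hr2 : ∀ᶠ ε in 𝓝[>] 0, r ε ≤ ε / 2) :
    Tendsto (fun ε => (ε / r ε) ^ 3 * ∫ x in suspensions Ω ε (r ε), h x) (𝓝[>] 0)
      (𝓝 (4 * Real.pi / 3 * ∫ x in Ω, h x)) := by
  obtain ⟨δ, hδ, hsum⟩ := eventually_integral_eq_sum_halfOpenCell hΩ hc hs hsΩ
  have hint : Integrable h := hc.integrable_of_hasCompactSupport hs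
  have huc : UniformContinuous h := hs.uniformContinuous_of_continuous hc
  rw [Metric.tendsto_nhds]
  intro τ hτ
  set V := volume.real (Ω : Set E3)
  have hV : 0 ≤ V := measureReal_nonneg
  -- The error is 2η (4π/3) ε³ per cell, at most 16 V η in total; the extra 1 makes the inequality
  -- strict and covers V = 0.
  set η := τ / (16 * V + 1) with hηdef
  have hη : 0 < η := by positivity
  obtain ⟨d, hd, hdη⟩ := Metric.uniformContinuous_iff.1 huc η hη
  filter_upwards [hr2, self_mem_nhdsWithin, Ioo_mem_nhdsGT (lt_min hδ hd)] with ε hrε hε hεd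
  have hε : 0 < ε := hε
  have hrp := hr ε hε
  have hosc : ∀ k, ∀ x ∈ Metric.ball (ε • latticePoint k) ε,
      |h x - h (ε • latticePoint k)| ≤ η := fun k x hx =>
    (hdη ((Metric.mem_ball.1 hx).trans (hεd.2.trans_le (min_le_right _ _)))).le
  have hcellv : ∀ k, volume.real (halfOpenCell ε k) = ε ^ 3 := fun k => by
    rw [measureReal_def, volume_halfOpenCell, ENNReal.toReal_pow, ENNReal.toReal_ofReal hε.le]
  -- Both terms are compared with (4π/3) ε³ h(εk), each with error η (4π/3) ε³.
  have hk : ∀ k, |(ε / r ε) ^ 3 * (∫ x in Metric.ball (ε • latticePoint k) (r ε), h x)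
      - 4 * Real.pi / 3 * ∫ x in halfOpenCell ε k, h x| ≤
      2 * η * (4 * Real.pi / 3 * ε ^ 3) := by
    intro k
    have b1 := abs_setIntegral_sub_le (A := Metric.ball (ε • latticePoint k) (r ε))
      (c := ε • latticePoint k) (η := η) hint.integrableOn measure_ball_lt_top
      fun x hx => hosc k x (Metric.ball_subset_ball (by linarith) hx)
    have b2 := abs_setIntegral_sub_le (A := halfOpenCell ε k)
      (c := ε • latticePoint k) (η := η) hint.integrableOn
      (by rw [volume_halfOpenCell]; exact ENNReal.pow_lt_top ENNReal.ofReal_lt_top)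
      fun x hx => hosc k x (halfOpenCell_subset_ball hε k hx)
    rw [hcellv] at b2
    rw [volume_real_ball _ hrp.le] at b1
    set I := ∫ x in Metric.ball (ε • latticePoint k) (r ε), h x
    set J := ∫ x in halfOpenCell ε k, h x
    set c := h (ε • latticePoint k)
    have hq : (ε / r ε) ^ 3 * r ε ^ 3 = ε ^ 3 := by field_simp
    have hpi := Real.pi_pos
    calc |(ε / r ε) ^ 3 * I - 4 * Real.pi / 3 * J|
        = |(ε / r ε) ^ 3 * (I - 4 * Real.pi / 3 * r ε ^ 3 * c)
          - 4 * Real.pi / 3 * (J - ε ^ 3 * c)| := by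
          congr 1; linear_combination (4 * Real.pi / 3 * c) * hq
      _ ≤ |(ε / r ε) ^ 3 * (I - 4 * Real.pi / 3 * r ε ^ 3 * c)|
          + |4 * Real.pi / 3 * (J - ε ^ 3 * c)| := abs_sub _ _
      _ = (ε / r ε) ^ 3 * |I - 4 * Real.pi / 3 * r ε ^ 3 * c|
          + 4 * Real.pi / 3 * |J - ε ^ 3 * c| := by
          rw [abs_mul, abs_mul, abs_of_pos (by positivity : 0 < (ε / r ε) ^ 3),
            abs_of_pos (by positivity : 0 < 4 * Real.pi / 3)]
      _ ≤ (ε / r ε) ^ 3 * (η * (4 * Real.pi / 3 * r ε ^ 3))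
          + 4 * Real.pi / 3 * (η * ε ^ 3) := by gcongr
      _ = _ := by linear_combination (η * (4 * Real.pi / 3)) * hq
  rw [hsum ε hε (hεd.2.trans_le (min_le_left _ _)),
    setIntegral_suspensions hΩ hε hrε hint.integrableOn, Finset.mul_sum, Finset.mul_sum,
    Real.dist_eq, ← Finset.sum_sub_distrib]
  have hcard := card_cellIndices_mul_le hΩ hε
  calc _ ≤ ∑ k ∈ (finite_cellIndices hΩ hε).toFinset, 2 * η * (4 * Real.pi / 3 * ε ^ 3) :=
        (Finset.abs_sum_le_sum_abs _ _).trans (Finset.sum_le_sum fun k _ => hk k)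
    _ = 2 * η * ((finite_cellIndices hΩ hε).toFinset.card * (4 * Real.pi / 3 * ε ^ 3)) := by
        rw [Finset.sum_const, nsmul_eq_mul]; ring
    _ ≤ 2 * η * (8 * V) := by gcongr
    _ < η * (16 * V + 1) := by linarith
    _ = τ := by rw [hηdef]; field_simp

/-! ### Weak convergence and density -/

/-- In a Hilbert space the weak topology of the dual is the topology of pointwise convergence. -/
lemma tendsto_toWeakSpace_strongDual {H α : Type*} [NormedAddCommGroup H] [InnerProductSpace ℝ H]
    [CompleteSpace H] {l : Filter α} {F : α → StrongDual ℝ H} {F₀ : StrongDual ℝ H}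
    (h : ∀ v, Tendsto (fun a => F a v) l (𝓝 (F₀ v))) :
    Tendsto (fun a => toWeakSpace ℝ (StrongDual ℝ H) (F a)) l
      (𝓝 (toWeakSpace ℝ (StrongDual ℝ H) F₀)) := by
  have hind : IsInducing fun (x : WeakSpace ℝ (StrongDual ℝ H))
      (ℓ : StrongDual ℝ (StrongDual ℝ H)) => ℓ ((toWeakSpace ℝ (StrongDual ℝ H)).symm x) := ⟨rfl⟩
  rw [hind.tendsto_nhds_iff, tendsto_pi_nhds]
  intro ℓ
  -- Reflexivity by applying Riesz twice: pulling `ℓ` back along `toDual` gives a functional on `H`,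
  -- whose Riesz vector `w` turns `ℓ` into evaluation at `w`.
  let m : StrongDual ℝ H :=
    { toFun := fun v => ℓ (InnerProductSpace.toDual ℝ H v)
      map_add' := fun v w => by rw [map_add, map_add]
      map_smul' := fun c v => by rw [LinearIsometryEquiv.map_smulₛₗ, map_smul]; simp
      cont := ℓ.continuous.comp (InnerProductSpace.toDual ℝ H).continuous }
  set w := (InnerProductSpace.toDual ℝ H).symm m with hw
  have key : ∀ G : StrongDual ℝ H, ℓ G = G w := by
    intro G
    obtain ⟨v, rfl⟩ := (InnerProductSpace.toDual ℝ H).surjective G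
    have h1 : inner ℝ w v = m v := InnerProductSpace.toDual_symm_apply
    rw [InnerProductSpace.toDual_apply_apply, real_inner_comm, h1]
    rfl
  have h2 := h w
  simp_rw [← key] at h2
  exact h2

/-- Pointwise convergence of functionals that are bounded on a subspace passes to its closure. -/
lemma tendsto_apply_of_mem_topologicalClosure {E α : Type*} [NormedAddCommGroup E]
    [NormedSpace ℝ E] {l : Filter α} {L : α → StrongDual ℝ E} {L₀ : StrongDual ℝ E}
    {P : Submodule ℝ E} {C : ℝ} (hb : ∀ᶠ a in l, ∀ p ∈ P, |L a p| ≤ C * ‖p‖)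
    (hp : ∀ p ∈ P, Tendsto (fun a => L a p) l (𝓝 (L₀ p))) {v : E}
    (hv : v ∈ P.topologicalClosure) : Tendsto (fun a => L a v) l (𝓝 (L₀ v)) := by
  rw [Metric.tendsto_nhds]
  intro τ hτ
  -- `C` has no assumed sign, hence |C|; the 1 keeps `D` positive.
  set D := |C| + ‖L₀‖ + 1
  have hD : 0 < D := by positivity
  obtain ⟨p, hpP, hpv⟩ := Metric.mem_closure_iff.1 (show v ∈ closure (P : Set E) from hv)
    (τ / (2 * D)) (by positivity)
  filter_upwards [hb, Metric.tendsto_nhds.1 (hp p hpP) (τ / 2) (by positivity)] with a ha1 ha2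
  -- Each `L a` is continuous, so its bound on `P` extends to the closure with the same constant.
  have hcl : ∀ u ∈ P.topologicalClosure, |L a u| ≤ C * ‖u‖ := by
    intro u hu
    have hcls : IsClosed {u : E | |L a u| ≤ C * ‖u‖} :=
      isClosed_le (L a).continuous.abs (continuous_const.mul continuous_norm)
    exact closure_minimal (fun q hq => ha1 q hq) hcls (show u ∈ closure (P : Set E) from hu)
  have h1 := hcl (v - p) (sub_mem hv (P.le_topologicalClosure hpP))
  have h2 : |L₀ (v - p)| ≤ ‖L₀‖ * ‖v - p‖ := L₀.le_opNorm _
  have h3 : C * ‖v - p‖ ≤ |C| * ‖v - p‖ := by gcongr; exact le_abs_self C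
  rw [dist_eq_norm] at hpv
  have h4 : D * ‖v - p‖ < τ / 2 := by
    calc D * ‖v - p‖ < D * (τ / (2 * D)) := by gcongr
      _ = τ / 2 := by field_simp
  have h5 : D * ‖v - p‖ = |C| * ‖v - p‖ + ‖L₀‖ * ‖v - p‖ + ‖v - p‖ := by ring
  have h6 := norm_nonneg (v - p)
  rw [Real.dist_eq] at ha2 ⊢
  have h7 : L a v - L₀ v = L a (v - p) + (L a p - L₀ p) - L₀ (v - p) := by
    simp only [map_sub]; ring
  rw [h7]
  calc _ ≤ |L a (v - p)| + |L a p - L₀ p| + |L₀ (v - p)| :=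
        (abs_sub _ _).trans (by gcongr; exact abs_add_le _ _)
    _ < τ := by linarith

/-! ### Completeness of the Sobolev spaces -/

/-- For each test function, the weak gradient identity equates two continuous linear maps of the
pair. The resulting completeness is what Riesz representation on `H₀¹(Ω)` needs. -/
lemma isClosed_sobolevH1 (Ω : Opens E3) : IsClosed (SobolevH1 Ω : Set (L2Pair Ω)) := by
  let B : ℝ →L[ℝ] E3 →L[ℝ] E3 := ContinuousLinearMap.lsmul ℝ ℝ
  have h : (SobolevH1 Ω : Set (L2Pair Ω)) = ⋂ ψ : 𝓓(Ω, ℝ), {v : L2Pair Ω |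
      B.lpPairing (volOn Ω) 2 2 v.fst ((memLp_gradient ψ 2 (volOn Ω)).toLp) =
        - B.lpPairing (volOn Ω) 2 2 ((memLp_testFunction ψ 2 (volOn Ω)).toLp) v.snd} := by
    ext v
    rw [Set.mem_iInter]
    refine forall_congr' fun ψ => ?_
    have h1 : B.lpPairing (volOn Ω) 2 2 v.fst ((memLp_gradient ψ 2 (volOn Ω)).toLp)
        = ∫ x, v.fst x • gradient ψ x ∂(volOn Ω) := by
      rw [ContinuousLinearMap.lpPairing_eq_integral]
      refine integral_congr_ae ?_
      filter_upwards [(memLp_gradient ψ 2 (volOn Ω)).coeFn_toLp] with x hx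
      rw [hx]; rfl
    have h2 : B.lpPairing (volOn Ω) 2 2 ((memLp_testFunction ψ 2 (volOn Ω)).toLp) v.snd
        = ∫ x, ψ x • v.snd x ∂(volOn Ω) := by
      rw [ContinuousLinearMap.lpPairing_eq_integral]
      refine integral_congr_ae ?_
      filter_upwards [(memLp_testFunction ψ 2 (volOn Ω)).coeFn_toLp] with x hx
      rw [hx]; rfl
    rw [Set.mem_ofPred_eq, h1, h2]
  rw [h]
  refine isClosed_iInter fun ψ => isClosed_eq ?_ ?_
  · exact ((B.lpPairing (volOn Ω) 2 2).flip _).continuous.comp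
      (WithLp.fstL 2 ℝ (Lp ℝ 2 (volOn Ω)) (Lp E3 2 (volOn Ω))).continuous
  · exact ((B.lpPairing (volOn Ω) 2 2 _).continuous.comp
      (WithLp.sndL 2 ℝ (Lp ℝ 2 (volOn Ω)) (Lp E3 2 (volOn Ω))).continuous).neg

instance completeSpace_sobolevH1 (Ω : Opens E3) : CompleteSpace (SobolevH1 Ω) :=
  (isClosed_sobolevH1 Ω).completeSpace_coe

instance completeSpace_sobolevH10 (Ω : Opens E3) : CompleteSpace (SobolevH10 Ω) :=
  (Submodule.isClosed_topologicalClosure _).completeSpace_coe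

/-! ### Classes of test functions and the uniform bound -/

/-- The class `v ∈ H¹(Ω)` is that of the test function `φ`. -/
def RepresentedBy {Ω : Opens E3} (v : SobolevH1 Ω) (φ : 𝓓(Ω, ℝ)) : Prop :=
  v.1.fst =ᵐ[volOn Ω] φ ∧ v.1.snd =ᵐ[volOn Ω] gradient φ

lemma differentiable_testFunction {Ω : Opens E3} (φ : 𝓓(Ω, ℝ)) : Differentiable ℝ φ :=
  ((TestFunctionClass.map_contDiff φ).of_le (by exact_mod_cast le_top :
    ((1 : ℕ∞) : WithTop ℕ∞) ≤ _)).differentiable one_ne_zero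

lemma RepresentedBy.zero {Ω : Opens E3} : RepresentedBy (0 : SobolevH1 Ω) 0 := by
  refine ⟨Lp.coeFn_zero ℝ 2 (volOn Ω), ?_⟩
  have h : gradient ((0 : 𝓓(Ω, ℝ)) : E3 → ℝ) = 0 := by
    funext x
    have : ((0 : 𝓓(Ω, ℝ)) : E3 → ℝ) = fun _ => 0 := rfl
    rw [this, gradient]; simp
  rw [h]
  exact Lp.coeFn_zero E3 2 (volOn Ω)

lemma RepresentedBy.add {Ω : Opens E3} {v w : SobolevH1 Ω} {φ ψ : 𝓓(Ω, ℝ)}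
    (hv : RepresentedBy v φ) (hw : RepresentedBy w ψ) : RepresentedBy (v + w) (φ + ψ) := by
  constructor
  · filter_upwards [hv.1, hw.1, Lp.coeFn_add v.1.fst w.1.fst] with x h1 h2 h3
    change (v.1.fst + w.1.fst : Lp ℝ 2 (volOn Ω)) x = φ x + ψ x
    rw [h3, Pi.add_apply, h1, h2]
  · filter_upwards [hv.2, hw.2, Lp.coeFn_add v.1.snd w.1.snd] with x h1 h2 h3
    change (v.1.snd + w.1.snd : Lp E3 2 (volOn Ω)) x = gradient (fun y => φ y + ψ y) x
    rw [h3, Pi.add_apply, h1, h2, gradient, gradient, gradient,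
      fderiv_fun_add (differentiable_testFunction φ x) (differentiable_testFunction ψ x), map_add]

lemma RepresentedBy.smul {Ω : Opens E3} {v : SobolevH1 Ω} {φ : 𝓓(Ω, ℝ)} (c : ℝ)
    (hv : RepresentedBy v φ) : RepresentedBy (c • v) (c • φ) := by
  constructor
  · filter_upwards [hv.1, Lp.coeFn_smul c v.1.fst] with x h1 h3
    change (c • v.1.fst : Lp ℝ 2 (volOn Ω)) x = c • φ x
    rw [h3, Pi.smul_apply, h1]
  · filter_upwards [hv.2, Lp.coeFn_smul c v.1.snd] with x h1 h3
    change (c • v.1.snd : Lp E3 2 (volOn Ω)) x = gradient (fun y => c • φ y) x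
    rw [h3, Pi.smul_apply, h1, gradient, gradient,
      fderiv_fun_const_smul (differentiable_testFunction φ x), LinearIsometryEquiv.map_smulₛₗ]
    simp

/-- The generators already form a subspace, so pointwise estimates for smooth functions apply to the
whole span. -/
lemma exists_representedBy_of_mem_span {Ω : Opens E3} {v : SobolevH1 Ω}
    (hv : v ∈ Submodule.span ℝ {v : SobolevH1 Ω | ∃ φ : 𝓓(Ω, ℝ),
      v.1.fst =ᵐ[volOn Ω] φ ∧ v.1.snd =ᵐ[volOn Ω] gradient φ}) :
    ∃ φ, RepresentedBy v φ := by
  induction hv using Submodule.span_induction with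
  | mem v h => exact h
  | zero => exact ⟨0, .zero⟩
  | add v w _ _ h1 h2 =>
    obtain ⟨φ, hφ⟩ := h1
    obtain ⟨ψ, hψ⟩ := h2
    exact ⟨φ + ψ, hφ.add hψ⟩
  | smul c v _ h1 =>
    obtain ⟨φ, hφ⟩ := h1
    exact ⟨c • φ, hφ.smul c⟩

lemma norm_sq_eq_integral_of_ae_eq {μ : Measure E3} {F : Type*} [NormedAddCommGroup F]
    [InnerProductSpace ℝ F] (u : Lp F 2 μ) {w : E3 → F} (h : u =ᵐ[μ] w) :
    ‖u‖ ^ 2 = ∫ x, ‖w x‖ ^ 2 ∂μ := by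
  rw [← real_inner_self_eq_norm_sq, L2.inner_def]
  refine integral_congr_ae ?_
  filter_upwards [h] with x hx
  rw [hx, real_inner_self_eq_norm_sq]

lemma RepresentedBy.norm_sq {Ω : Opens E3} {v : SobolevH1 Ω} {φ : 𝓓(Ω, ℝ)}
    (hv : RepresentedBy v φ) :
    ‖v‖ ^ 2 = (∫ x in Ω, φ x ^ 2) + ∫ x in Ω, ‖fderiv ℝ φ x‖ ^ 2 := by
  change ‖v.1‖ ^ 2 = _
  rw [WithLp.prod_norm_sq_eq_of_L2]
  congr 1
  · rw [norm_sq_eq_integral_of_ae_eq _ hv.1]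
    simp
  · rw [norm_sq_eq_integral_of_ae_eq _ hv.2]
    simp [gradient]

lemma volOn_restrict_suspensions {Ω : Opens E3} {ε ρ : ℝ} (hε : 0 < ε) (hρ : ρ ≤ ε / 2) :
    (volOn Ω).restrict (suspensions Ω ε ρ) = volume.restrict (suspensions Ω ε ρ) :=
  Measure.restrict_restrict_of_subset (suspensions_subset hε hρ)

lemma integralL2_apply (Ω : Opens E3) (A : Set E3) (h : CcFun Ω) (u : Lp ℝ 2 (volOn Ω)) :
    integralL2 Ω A h u = ∫ x in A, h x * u x ∂(volOn Ω) := rfl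

lemma RepresentedBy.integralL2_suspensions {Ω : Opens E3} {v : SobolevH1 Ω} {φ : 𝓓(Ω, ℝ)}
    (hv : RepresentedBy v φ) (g : CcFun Ω) {ε ρ : ℝ} (hε : 0 < ε) (hρ : ρ ≤ ε / 2) :
    integralL2 Ω (suspensions Ω ε ρ) g v.1.fst = ∫ x in suspensions Ω ε ρ, g x * φ x := by
  rw [integralL2_apply, ← volOn_restrict_suspensions hε hρ]
  refine integral_congr_ae (ae_restrict_of_ae ?_)
  filter_upwards [hv.1] with x hx
  rw [hx]

/-- The restriction of `integralL2` to `H¹(Ω)`. -/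
noncomputable def integralH1 (Ω : Opens E3) (A : Set E3) (h : CcFun Ω) :
    StrongDual ℝ (SobolevH1 Ω) :=
  (integralL2 Ω A h).comp ((WithLp.fstL 2 ℝ (Lp ℝ 2 (volOn Ω)) (Lp E3 2 (volOn Ω))).comp
    (SobolevH1 Ω).subtypeL)

lemma integralH1_apply (Ω : Opens E3) (A : Set E3) (h : CcFun Ω) (v : SobolevH1 Ω) :
    integralH1 Ω A h v = integralL2 Ω A h v.1.fst := rfl

/-- The critical-size estimate with |φ| ≤ 1/2 + φ²/2: the term 8 ∫|φ| costs 4|Ω| + 4, the cell count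
8|Ω|, and the gradient M. -/
lemma RepresentedBy.abs_integralH1_le {Ω : Opens E3} (hΩ : Bornology.IsBounded (Ω : Set E3))
    {v : SobolevH1 Ω} {φ : 𝓓(Ω, ℝ)} (hv : RepresentedBy v φ) {g : CcFun Ω} {K : ℝ}
    (hK : ∀ x, |g x| ≤ K) {ε ρ M : ℝ} (hρ0 : 0 < ρ) (hρ : ρ ≤ ε / 2) (hM : ε ^ 3 / ρ ≤ M)
    (hv1 : ‖v‖ ≤ 1) :
    |(ε / ρ) ^ 3 * integralH1 Ω (suspensions Ω ε ρ) g v| ≤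
      K * (12 * volume.real (Ω : Set E3) + 4 + M) := by
  have hε : 0 < ε := by linarith
  have hK0 : 0 ≤ K := (abs_nonneg _).trans (hK 0)
  have hM0 : 0 ≤ M := le_trans (by positivity) hM
  have hcK : IsCompact (closure (Ω : Set E3)) := hΩ.isCompact_closure
  have hcφ : Continuous φ := map_continuous φ
  have hi : ∀ {w : E3 → ℝ}, Continuous w → IntegrableOn w (Ω : Set E3) := fun hw =>
    (hw.continuousOn.integrableOn_compact hcK).mono_set subset_closure
  have hn := hv.norm_sq
  have hn1 : ‖v‖ ^ 2 ≤ 1 := pow_le_one₀ (norm_nonneg _) hv1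
  have p1 : 0 ≤ ∫ x in Ω, φ x ^ 2 := integral_nonneg fun _ => by positivity
  have p2 : 0 ≤ ∫ x in Ω, ‖fderiv ℝ φ x‖ ^ 2 := integral_nonneg fun _ => by positivity
  have hL1 : ∫ x in Ω, |φ x| ≤ 1 / 2 * volume.real (Ω : Set E3) + 1 / 2 * ∫ x in Ω, φ x ^ 2 := by
    calc ∫ x in Ω, |φ x| ≤ ∫ x in Ω, (1 / 2 + 1 / 2 * φ x ^ 2) := by
          refine setIntegral_mono (hi hcφ.abs) (hi (by fun_prop)) fun x => ?_
          nlinarith [sq_nonneg (|φ x| - 1), sq_abs (φ x)]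
      _ = _ := by
          rw [integral_add (hi continuous_const) (hi (by fun_prop)), setIntegral_const,
            integral_const_mul, smul_eq_mul, mul_comm]
  have hcrit := integral_abs_suspensions_le hΩ hρ0 hρ φ
  have hsub := suspensions_subset (Ω := Ω) hε hρ
  rw [integralH1_apply, hv.integralL2_suspensions g hε hρ, abs_mul,
    abs_of_pos (by positivity : 0 < (ε / ρ) ^ 3)]
  have hg : |∫ x in suspensions Ω ε ρ, g x * φ x| ≤ K * ∫ x in suspensions Ω ε ρ, |φ x| := by
    rw [← integral_const_mul]
    refine (abs_integral_le_integral_abs).trans (setIntegral_mono ?_ ?_ fun x => ?_)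
    · exact (hi ((map_continuous g).mul hcφ).abs).mono_set hsub
    · exact (hi (hcφ.abs.const_mul K)).mono_set hsub
    · simp only [abs_mul]
      exact mul_le_mul_of_nonneg_right (hK x) (abs_nonneg _)
  have hgrad : ε ^ 3 / ρ * ∫ x in Ω, ‖fderiv ℝ φ x‖ ^ 2 ≤ M * 1 :=
    mul_le_mul hM (by linarith) p2 hM0
  calc _ ≤ (ε / ρ) ^ 3 * (K * ∫ x in suspensions Ω ε ρ, |φ x|) := by gcongr
    _ = K * ((ε / ρ) ^ 3 * ∫ x in suspensions Ω ε ρ, |φ x|) := by ring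
    _ ≤ _ := by gcongr; linarith

/-- Young's inequality made the previous bound inhomogeneous; normalizing `v` restores homogeneity.
-/
lemma abs_integralH1_le_mul_norm {Ω : Opens E3} (hΩ : Bornology.IsBounded (Ω : Set E3))
    {g : CcFun Ω} {K : ℝ} (hK : ∀ x, |g x| ≤ K) {ε ρ M : ℝ} (hρ0 : 0 < ρ) (hρ : ρ ≤ ε / 2)
    (hM : ε ^ 3 / ρ ≤ M) {v : SobolevH1 Ω} {φ : 𝓓(Ω, ℝ)} (hv : RepresentedBy v φ) :
    |(ε / ρ) ^ 3 * integralH1 Ω (suspensions Ω ε ρ) g v| ≤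
      K * (12 * volume.real (Ω : Set E3) + 4 + M) * ‖v‖ := by
  rcases eq_or_ne v 0 with rfl | hne
  · simp
  have hn : 0 < ‖v‖ := norm_pos_iff.2 hne
  have h := (hv.smul ‖v‖⁻¹).abs_integralH1_le hΩ hK hρ0 hρ hM
    (by rw [norm_smul, norm_inv, norm_norm, inv_mul_cancel₀ hn.ne'])
  rw [map_smul, smul_eq_mul, mul_left_comm, abs_mul, abs_inv, abs_norm,
    inv_mul_le_iff₀ hn] at h
  linarith

/-! ### Convergence of the two terms -/

/-- Absolute continuity of the integral: the removed set has vanishing volume. This works for every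
`u` in L², without density. -/
lemma tendsto_integralL2_fluidDomain {Ω : Opens E3} (hΩ : Bornology.IsBounded (Ω : Set E3))
    (f : CcFun Ω) (u : Lp ℝ 2 (volOn Ω)) {r : ℝ → ℝ} (hr : ∀ ε, 0 < ε → 0 < r ε)
    (hr0 : Tendsto (fun ε => r ε / ε) (𝓝[>] 0) (𝓝 0))
    (hr2 : ∀ᶠ ε in 𝓝[>] 0, r ε ≤ ε / 2) :
    Tendsto (fun ε => integralL2 Ω (fluidDomain Ω ε (r ε)) f u) (𝓝[>] 0)
      (𝓝 (integralL2 Ω Ω f u)) := by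
  have hint := integrable_mul_Lp f u
  have hvol : Tendsto (fun ε => volOn Ω (suspensions Ω ε (r ε))) (𝓝[>] 0) (𝓝 0) := by
    have hlim : Tendsto (fun ε => ENNReal.ofReal (8 * volume.real (Ω : Set E3) * (r ε / ε) ^ 3))
        (𝓝[>] 0) (𝓝 0) := by
      simpa using ENNReal.tendsto_ofReal ((hr0.pow 3).const_mul (8 * volume.real (Ω : Set E3)))
    refine tendsto_of_tendsto_of_tendsto_of_le_of_le' tendsto_const_nhds hlim
      (Eventually.of_forall fun _ => zero_le) ?_
    filter_upwards [hr2, self_mem_nhdsWithin] with ε h2 hε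
    refine (Measure.restrict_apply_le _ _).trans ?_
    have hfin : volume (suspensions Ω ε (r ε)) ≠ ∞ := ne_top_of_le_ne_top
      (volume_ne_top_of_isBounded hΩ) (measure_mono (suspensions_subset hε h2))
    rw [← ENNReal.ofReal_toReal hfin]
    exact ENNReal.ofReal_le_ofReal (volume_real_suspensions_le hΩ hε (hr ε hε).le h2)
  have h0 := hint.tendsto_setIntegral_nhds_zero hvol
  have h1 := (tendsto_const_nhds (x := integralL2 Ω Ω f u)).sub h0
  rw [sub_zero] at h1
  refine h1.congr' ?_
  filter_upwards [hr2, self_mem_nhdsWithin] with ε h2 hε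
  rw [integralL2_apply, integralL2_apply, fluidDomain,
    setIntegral_sdiff (isOpen_suspensions Ω ε _).measurableSet hint.integrableOn
      (suspensions_subset hε h2)]

lemma RepresentedBy.tendsto_integralH1 {Ω : Opens E3} (hΩ : Bornology.IsBounded (Ω : Set E3))
    {v : SobolevH1 Ω} {φ : 𝓓(Ω, ℝ)} (hv : RepresentedBy v φ) (g : CcFun Ω)
    {r : ℝ → ℝ} (hr : ∀ ε, 0 < ε → 0 < r ε) (hr2 : ∀ᶠ ε in 𝓝[>] 0, r ε ≤ ε / 2) :
    Tendsto (fun ε => (ε / r ε) ^ 3 * integralH1 Ω (suspensions Ω ε (r ε)) g v) (𝓝[>] 0)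
      (𝓝 (4 * Real.pi / 3 * integralH1 Ω Ω g v)) := by
  have hlim : integralH1 Ω Ω g v = ∫ x in Ω, g x * φ x := by
    rw [integralH1_apply, integralL2_apply, Measure.restrict_restrict_of_subset subset_rfl]
    refine integral_congr_ae ?_
    filter_upwards [hv.1] with x hx
    rw [hx]
  have h := tendsto_integral_suspensions hΩ (h := fun x => g x * φ x)
    ((map_continuous g).mul (map_continuous φ))
    ((TestFunctionClass.map_hasCompactSupport g).mul_right)
    ((tsupport_mul_subset_left (f := g) (g := φ)).trans (TestFunctionClass.tsupport_map_subset g))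
    hr hr2
  rw [hlim]
  refine h.congr' ?_
  filter_upwards [hr2, self_mem_nhdsWithin] with ε h2 hε
  rw [integralH1_apply, hv.integralL2_suspensions g hε h2]

/-- The limit of r/ε³ enters twice: r/ε = (r/ε³) ε² tends to 0, and ε³/r is eventually at most γ⁻¹ +
1 because γ > 0. -/
lemma tendsto_heatSource_apply {Ω : Opens E3} (hΩ : Bornology.IsBounded (Ω : Set E3))
    (b : ℝ) (f g : CcFun Ω) {r : ℝ → ℝ} (hr : ∀ ε, 0 < ε → 0 < r ε)
    {γ : ℝ} (hγ : 0 < γ) (hrγ : Tendsto (fun ε => r ε / ε ^ 3) (𝓝[>] 0) (𝓝 γ))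
    (φ : SobolevH10 Ω) :
    Tendsto (fun ε => heatSource Ω b f g ε (r ε) φ) (𝓝[>] 0)
      (𝓝 (limitHeatSource Ω b f g φ)) := by
  have hid : Tendsto (fun ε : ℝ => ε) (𝓝[>] 0) (𝓝 0) :=
    tendsto_nhdsWithin_of_tendsto_nhds tendsto_id
  have hr0 : Tendsto (fun ε => r ε / ε) (𝓝[>] 0) (𝓝 0) := by
    have h := hrγ.mul (hid.pow 2)
    rw [zero_pow two_ne_zero, mul_zero] at h
    refine h.congr' ?_
    filter_upwards [self_mem_nhdsWithin] with ε hε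
    have : ε ≠ 0 := (Set.mem_Ioi.1 hε).ne'
    field_simp
  have hr2 : ∀ᶠ ε in 𝓝[>] 0, r ε ≤ ε / 2 := by
    filter_upwards [hr0.eventually_le_const (by norm_num : (0 : ℝ) < 1 / 2),
      self_mem_nhdsWithin] with ε h hε
    rw [div_le_iff₀ hε] at h
    linarith
  have hM : ∀ᶠ ε in 𝓝[>] 0, ε ^ 3 / r ε ≤ γ⁻¹ + 1 := by
    filter_upwards [(hrγ.inv₀ hγ.ne').eventually_le_const (lt_add_one γ⁻¹)] with ε h
    rwa [inv_div] at h
  obtain ⟨K, hK⟩ := (map_continuous g).bounded_above_of_compact_support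
    (TestFunctionClass.map_hasCompactSupport g)
  have hg : Tendsto (fun ε => ((ε / r ε) ^ 3 • integralH1 Ω (suspensions Ω ε (r ε)) g) φ.1)
      (𝓝[>] 0) (𝓝 (((4 * Real.pi / 3) • integralH1 Ω Ω g) φ.1)) := by
    refine tendsto_apply_of_mem_topologicalClosure
      (C := K * (12 * volume.real (Ω : Set E3) + 4 + (γ⁻¹ + 1))) ?_ ?_ φ.2
    · filter_upwards [hr2, hM, self_mem_nhdsWithin] with ε h2 h3 hε p hp
      obtain ⟨ψ, hψ⟩ := exists_representedBy_of_mem_span hp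
      exact abs_integralH1_le_mul_norm hΩ hK (hr ε hε) h2 h3 hψ
    · intro p hp
      obtain ⟨ψ, hψ⟩ := exists_representedBy_of_mem_span hp
      exact hψ.tendsto_integralH1 hΩ g hr hr2
  have hf := tendsto_integralL2_fluidDomain hΩ f (SobolevH10.toL2 Ω φ) hr hr0 hr2
  have hlim : limitHeatSource Ω b f g φ = integralL2 Ω Ω f (SobolevH10.toL2 Ω φ)
      + b * ((4 * Real.pi / 3) • integralH1 Ω Ω g) φ.1 := by
    change integralL2 Ω Ω f (SobolevH10.toL2 Ω φ)
      + (4 * Real.pi * b / 3) * integralH1 Ω Ω g φ.1 = _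
    simp only [smul_apply, smul_eq_mul]
    ring
  rw [hlim]
  refine (hf.add (hg.const_mul b)).congr fun ε => ?_
  change _ = integralL2 Ω (fluidDomain Ω ε (r ε)) f (SobolevH10.toL2 Ω φ)
    + (b * (ε / r ε) ^ 3) * integralH1 Ω (suspensions Ω ε (r ε)) g φ.1
  simp only [smul_apply, smul_eq_mul]
  ring

theorem proposition3p1 (Ω : Opens E3) (hΩ : Bornology.IsBounded (Ω : Set E3))
    (b : ℝ) (hb : 0 < b) (f g : CcFun Ω)
    (r : ℝ → ℝ) (hr : ∀ ε, 0 < ε → 0 < r ε)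
    (γ : ℝ) (hγ : 0 < γ) (hrγ : Tendsto (fun ε => r ε / ε ^ 3) (𝓝[>] 0) (𝓝 γ)) :
    Tendsto (fun ε => toWeakSpace ℝ (SobolevHMinus1 Ω) (heatSource Ω b f g ε (r ε)))
      (𝓝[>] 0) (𝓝 (toWeakSpace ℝ (SobolevHMinus1 Ω) (limitHeatSource Ω b f g))) := by
  have h := @tendsto_toWeakSpace_strongDual (SobolevH10 Ω) ℝ _ _ _ (𝓝[>] 0)
  exact @h (fun ε => heatSource Ω b f g ε (r ε)) (limitHeatSource Ω b f g)
    (tendsto_heatSource_apply hΩ b f g hr hγ hrγ)
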